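/- Let $\alpha=\frac{1+\sqrt5}{2}$ and, for every positive integer $t$, let $\tau(t)=\frac{\alpha^t+1}{\sqrt5}$. Let $a_1,a_2,\Delta$ be integers with $0<a_1<a_2$, and let $t,t_1,t_2$ be positive integers. Put \begin{align*} \Lambda_{4a}&=\Delta\log\alpha-a_1\log\sqrt5-a_2\log\tau(t),\\ \Lambda_{4b}&=\Delta\log\alpha-a_2\log\sqrt5-a_1\log\tau(t),\\ \Lambda_5&=\Delta\log\alpha-a_1\log\tau(t_1)+a_2\log\tau(t_2). \end{align*} Then $\Lambda_{4a}\neq0$ and $\Lambda_{4b}\neq0$, and $\Lambda_5=0$ if and only if $t_1=t_2=2$ and $\Delta+a_2-a_1=0$. -/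

import Mathlib

/-- `τ(t) = (α ^ t + 1) / √5`, where `α = (1 + √5) / 2` is the golden ratio. -/
noncomputable def tau (t : ℕ) : ℝ := (Real.goldenRatio ^ t + 1) / √5

/-- `Λ₄ₐ = Δ log α - a₁ log √5 - a₂ log τ(t)`. -/
noncomputable def Lambda4a (Δ a₁ a₂ : ℤ) (t : ℕ) : ℝ :=
  Δ * Real.log Real.goldenRatio - a₁ * Real.log √5 - a₂ * Real.log (tau t)

/-- `Λ₄ᵦ = Δ log α - a₂ log √5 - a₁ log τ(t)`. -/
noncomputable def Lambda4b (Δ a₁ a₂ : ℤ) (t : ℕ) : ℝ :=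
  Δ * Real.log Real.goldenRatio - a₂ * Real.log √5 - a₁ * Real.log (tau t)

/-- `Λ₅ = Δ log α - a₁ log τ(t₁) + a₂ log τ(t₂)`. -/
noncomputable def Lambda5 (Δ a₁ a₂ : ℤ) (t₁ t₂ : ℕ) : ℝ :=
  Δ * Real.log Real.goldenRatio - a₁ * Real.log (tau t₁) + a₂ * Real.log (tau t₂)

/-! A vanishing form is a multiplicative relation between `φ`, `√5` and the `φ ^ t + 1`. Multiplying
it by its conjugate turns it into an integer relation between powers of 5 and the norms `N(t)` of `φ
^ t + 1` (`norm_eq_of_log_eq`). For `Λ₄ₐ` it reads `5 ^ (a₂ - a₁) = N(t) ^ a₂`, impossible since `0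
< a₂ - a₁ < a₂`; for `Λ₄ᵦ` it reads `5 ^ a₁ = 5 ^ a₂ * N(t) ^ a₁`, impossible by size. For `Λ₅`,
divisibility by 5 forces `t₂ = 2m` and `t₁ = 2n` with `m`, `n` odd, where `N(2m) = 5 F_m ^ 2`. What
remains is `F_m ^ a₂ = F_n ^ a₁`, and new prime factors of Fibonacci numbers force `m = n = 1`. -/

/-! ### Prime factors and powers of Fibonacci numbers -/

/-- Binomial expansion of `(F_(e+1) φ + F_e) ^ (k+2)`, where the base is `φ ^ (e+1)`. -/
theorem fib_mul_expansion (e k : ℕ) :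
    ∃ c f : ℕ, Nat.fib ((e + 1) * (k + 2) - 1) = Nat.fib e ^ (k + 2) + Nat.fib (e + 1) ^ 2 * c ∧
      Nat.fib ((e + 1) * (k + 2)) = (k + 2) * Nat.fib (e + 1) * Nat.fib e ^ (k + 1) +
        (k + 2).choose 2 * Nat.fib (e + 1) ^ 2 * Nat.fib e ^ k + Nat.fib (e + 1) ^ 3 * f := by
  induction k with
  | zero =>
    refine ⟨1, 0, ?_, ?_⟩
    · rw [show (e + 1) * (0 + 2) - 1 = e + e + 1 by omega, Nat.fib_add]; ring
    · rw [show (e + 1) * (0 + 2) = (e + 1) + e + 1 by omega, Nat.fib_add,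
        Nat.fib_add_two (n := e)]
      simp; ring
  | succ k ih =>
    obtain ⟨c, f, hv, hu⟩ := ih
    obtain ⟨M, hM⟩ : ∃ M, (e + 1) * (k + 2) = M + 1 := ⟨(e + 1) * (k + 2) - 1, by
      have : 0 < (e + 1) * (k + 2) := by positivity
      omega⟩
    have h3 : (e + 1) * (k + 1 + 2) = M + 1 + e + 1 := by
      rw [show k + 1 + 2 = k + 2 + 1 by ring, mul_add _ (k + 2), hM]; ring
    have hC : (k + 1 + 2).choose 2 = (k + 2) + (k + 2).choose 2 := by
      rw [show k + 1 + 2 = (k + 2) + 1 by ring, Nat.choose_succ_succ' (k + 2) 1, Nat.choose_one_right]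
    rw [hM, Nat.add_sub_cancel] at hv
    rw [hM] at hu
    rw [h3, hC, Nat.add_sub_cancel, Nat.fib_add (M + 1) e, Nat.fib_add_two (n := M), 
      show M + 1 + e = M + e + 1 by ring, Nat.fib_add M e, hu, hv]
    generalize (k + 2).choose 2 = C
    generalize Nat.fib (e + 1) = x
    generalize Nat.fib e = y
    refine ⟨c * y + (k + 2) * y ^ (k + 1) + C * x * y ^ k + x ^ 2 * f, f * y + C * y ^ k + x * f + c, ?_, ?_⟩
    · ring
    · ring

theorem three_pow_mul_fib_le (e k : ℕ) (he : 2 ≤ e) :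
    3 ^ k * Nat.fib (e + 1) ≤ Nat.fib ((e + 1) * (k + 1)) := by
  induction k with
  | zero => simp
  | succ k ih =>
    have h3 : 3 ≤ Nat.fib (e + 2) := Nat.fib_mono (show 4 ≤ e + 2 by omega)
    obtain ⟨M, hM⟩ : ∃ M, (e + 1) * (k + 1) = M + 1 := ⟨(e + 1) * (k + 1) - 1, by
      have : 0 < (e + 1) * (k + 1) := by positivity
      omega⟩
    have : (e + 1) * (k + 1 + 1) = M + (e + 1) + 1 := by rw [mul_add _ (k+1), hM]; ring
    rw [this, Nat.fib_add M (e + 1), pow_succ]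
    rw [hM] at ih
    nlinarith [Nat.zero_le (Nat.fib M * Nat.fib (e + 1)), Nat.mul_le_mul ih h3]

/-- For `m ≥ 3`, passing from `fib m` to `fib (m * p)` with `p` an odd prime brings in a new prime. -/
theorem exists_prime_dvd_fib_mul_not_dvd (m p : ℕ) (hm : 3 ≤ m) (hp : p.Prime) (hp2 : p ≠ 2) :
    ∃ q, q.Prime ∧ q ∣ Nat.fib (m * p) ∧ ¬ q ∣ Nat.fib m := by
  by_contra! hall
  obtain ⟨e, rfl⟩ : ∃ e, m = e + 1 := ⟨m - 1, by omega⟩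
  obtain ⟨k, rfl⟩ : ∃ k, p = k + 2 := ⟨p - 2, by have := hp.two_le; omega⟩
  obtain ⟨_, f, -, hu⟩ := fib_mul_expansion e k
  have hx : 0 < Nat.fib (e + 1) := Nat.fib_pos.2 (by omega)
  have hcop : Nat.Coprime (Nat.fib e) (Nat.fib (e + 1)) := Nat.fib_coprime_fib_succ e
  set Q := (k + 2) * Nat.fib e ^ (k + 1) +
    (k + 2).choose 2 * Nat.fib (e + 1) * Nat.fib e ^ k + Nat.fib (e + 1) ^ 2 * f with hQ
  have hFQ : Nat.fib ((e + 1) * (k + 2)) = Nat.fib (e + 1) * Q := by rw [hu, hQ]; ring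
  have hlow : 3 ^ (k + 1) ≤ Q := by
    have := three_pow_mul_fib_le e (k + 1) (by omega)
    rw [show k + 1 + 1 = k + 2 from rfl, hFQ, mul_comm] at this
    exact Nat.le_of_mul_le_mul_left this hx
  -- Modulo a prime `q` dividing `F_(e+1)`, only the first term of `Q` survives, and `F_e` is a
  -- unit.
  have hdvd : ∀ {q : ℕ}, q.Prime → q ∣ Q → q = k + 2 := by
    intro q hq hqQ
    have hqx : q ∣ Nat.fib (e + 1) := hall q hq (hFQ ▸ hqQ.mul_left _)
    have h1 : q ∣ (k + 2) * Nat.fib e ^ (k + 1) := by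
      rw [hQ, add_assoc] at hqQ
      refine (Nat.dvd_add_left ?_).1 hqQ
      exact dvd_add ((hqx.mul_left _).mul_right _) ((dvd_pow hqx two_ne_zero).mul_right _)
    rcases hq.dvd_mul.1 h1 with h | h
    · exact (Nat.prime_dvd_prime_iff_eq hq hp).1 h
    · exact absurd (Nat.eq_one_of_dvd_coprimes hcop (hq.dvd_of_dvd_pow h) hqx) hq.ne_one
  have hQ1 : Q ≠ 1 := by
    have : 1 < 3 ^ (k + 1) := Nat.one_lt_pow (by omega) (by omega)
    omega
  have hQ0 : Q ≠ 0 := by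
    have : 0 < 3 ^ (k + 1) := by positivity
    omega
  have hpQ : k + 2 ∣ Q := by
    obtain ⟨q, hq, hqQ⟩ := Nat.exists_prime_and_dvd hQ1
    exact hdvd hq hqQ ▸ hqQ
  have hpx : k + 2 ∣ Nat.fib (e + 1) := hall _ hp (hFQ ▸ hpQ.mul_left _)
  have hpow := Nat.eq_prime_pow_of_unique_prime_dvd hQ0 hdvd
  -- For odd `p = k + 2`, `p` divides `p.choose 2`, so every term of `Q` but the first vanishes
  -- modulo `p ^ 2`. Hence `Q ≤ p`, against `Q ≥ 3 ^ (p - 1)`.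
  have hsq : ¬ (k + 2) ^ 2 ∣ Q := by
    intro h
    have hch : k + 2 ∣ (k + 2).choose 2 := hp.dvd_choose_self two_ne_zero (by
      have := hp.two_le; omega)
    rw [hQ, add_assoc] at h
    have h1 := (Nat.dvd_add_left (dvd_add
      (((sq (k + 2)) ▸ mul_dvd_mul hch hpx).mul_right _)
      ((pow_dvd_pow_of_dvd hpx 2).mul_right _))).1 h
    rw [sq] at h1
    have h2 := hp.dvd_of_dvd_pow (Nat.dvd_of_mul_dvd_mul_left (by omega) h1)
    exact hp.one_lt.ne' (Nat.eq_one_of_dvd_coprimes hcop h2 hpx)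
  have hle : Q ≤ k + 2 := by
    rw [hpow] at hsq ⊢
    have : Q.primeFactorsList.length < 2 := by
      by_contra! h
      exact hsq (pow_dvd_pow _ h)
    calc (k + 2) ^ Q.primeFactorsList.length ≤ (k + 2) ^ 1 := Nat.pow_le_pow_right (by omega) (by omega)
      _ = k + 2 := pow_one _
  have h9 : k + 2 < 3 ^ (k + 1) := by
    clear * -
    induction k with
    | zero => norm_num
    | succ k ih => rw [pow_succ]; omega
  omega

/-- Both Fibonacci numbers have the same primes, and `b < a` gives `F_m ∣ F_n`, hence `m ∣ n` when
`m ≥ 3`. An odd prime factor of `n / m` would then bring a new prime into `F_n`. -/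
theorem eq_one_of_fib_pow_eq_fib_pow {m n a b : ℕ} (hm : Odd m) (hn : Odd n) (hb : 0 < b)
    (hba : b < a) (h : Nat.fib m ^ a = Nat.fib n ^ b) : m = 1 ∧ n = 1 := by
  have key : ∀ {r : ℕ}, Odd r → Nat.fib r = 1 → r = 1 := by
    intro r hr h1
    by_contra hne
    have h3 : 3 ≤ r := by obtain ⟨s, rfl⟩ := hr; omega
    have : 2 ≤ Nat.fib r := Nat.fib_mono h3
    omega
  by_cases hm1 : m = 1
  · subst hm1
    rw [Nat.fib_one, one_pow] at h
    exact ⟨rfl, key hn ((Nat.pow_eq_one.1 h.symm).resolve_right hb.ne')⟩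
  exfalso
  have hm3 : 3 ≤ m := by obtain ⟨s, rfl⟩ := hm; omega
  have hF2 : 2 ≤ Nat.fib m := Nat.fib_mono hm3
  have hdvd : Nat.fib m ∣ Nat.fib n :=
    (Nat.pow_dvd_pow_iff hb.ne').1 (h ▸ pow_dvd_pow _ hba.le)
  have hmn : m ∣ n := by
    have h1 : Nat.fib (Nat.gcd m n) = Nat.fib m := by rw [Nat.fib_gcd, Nat.gcd_eq_left hdvd]
    have hle : Nat.gcd m n ≤ m := Nat.gcd_le_left _ (by omega)
    have : Nat.gcd m n = m := by
      by_contra hne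
      have : Nat.fib (Nat.gcd m n) < Nat.fib m := by
        calc Nat.fib (Nat.gcd m n) ≤ Nat.fib (m - 1) := Nat.fib_mono (by omega)
          _ < Nat.fib (m - 1 + 1) := Nat.fib_lt_fib_succ (by omega)
          _ = Nat.fib m := by congr 1; omega
      omega
    exact this ▸ Nat.gcd_dvd_right m n
  obtain ⟨k, rfl⟩ := hmn
  have hk1 : k ≠ 1 := by
    rintro rfl
    rw [mul_one] at h
    exact hba.ne' (Nat.pow_right_injective hF2 h)
  obtain ⟨p, hp, hpk⟩ := Nat.exists_prime_and_dvd hk1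
  have hp2 : p ≠ 2 := by
    rintro rfl
    exact Nat.not_even_iff_odd.2 hn (even_iff_two_dvd.2 (hpk.mul_left m))
  obtain ⟨q, hq, hqd, hqn⟩ := exists_prime_dvd_fib_mul_not_dvd m p hm3 hp hp2
  have h1 : q ∣ Nat.fib (m * k) := hqd.trans (Nat.fib_dvd _ _ (Nat.mul_dvd_mul_left m hpk))
  exact hqn (hq.dvd_of_dvd_pow (h ▸ dvd_pow h1 hb.ne'))

/-! ### Conjugation and norms -/

open scoped Polynomial in
/-- An integer polynomial vanishing at the golden ratio vanishes at its conjugate. -/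
theorem aeval_goldenConj_eq_zero (P : ℤ[X]) (h : P.aeval Real.goldenRatio = 0) :
    P.aeval Real.goldenConj = 0 := by
  have hq : (Polynomial.X ^ 2 - (Polynomial.X + 1) : ℤ[X]).Monic := by monicity!
  set q : ℤ[X] := Polynomial.X ^ 2 - (Polynomial.X + 1) with hqdef
  have hdeg : (P %ₘ q).natDegree < 2 := by
    have h2 : q.natDegree = 2 := by rw [hqdef]; compute_degree!
    exact h2 ▸ Polynomial.natDegree_modByMonic_lt P hq (by rintro h1; simp [h1] at h2)
  obtain ⟨a, b, hab⟩ := Polynomial.exists_eq_X_add_C_of_natDegree_le_one (Nat.le_of_lt_succ hdeg)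
  have hP : P = Polynomial.C a * Polynomial.X + Polynomial.C b + q * (P /ₘ q) := by
    rw [← hab, Polynomial.modByMonic_add_div]
  have hab0 : a * Real.goldenRatio + b = 0 := by
    rw [hP] at h
    simpa [hqdef] using h
  have ha : a = 0 := by
    by_contra ha
    refine Real.goldenRatio_irrational ⟨-b / a, ?_⟩
    have : (a : ℝ) ≠ 0 := Int.cast_ne_zero.2 ha
    push_cast
    rw [div_eq_iff this]
    linarith
  have hb : b = 0 := by
    rw [ha] at hab0
    exact_mod_cast (by simpa using hab0 : (b : ℝ) = 0)
  rw [hP, ha, hb]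
  simp [hqdef]

/-- The norm of `φ ^ t + 1` in `ℤ[φ]`. -/
def goldenPowAddOneNorm (t : ℕ) : ℕ :=
  2 * Nat.fib (t + 1) - Nat.fib t + if Even t then 2 else 0

theorem cast_goldenPowAddOneNorm (t : ℕ) :
    (goldenPowAddOneNorm t : ℝ) = (Real.goldenRatio ^ t + 1) * (Real.goldenConj ^ t + 1) := by
  have h1 := Real.fib_succ_sub_goldenRatio_mul_fib t
  have h2 := Real.fib_succ_sub_goldenConj_mul_fib t
  have h3 : Real.goldenRatio ^ t * Real.goldenConj ^ t = (-1) ^ t := by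
    rw [← mul_pow, Real.goldenRatio_mul_goldenConj]
  have h4 : Nat.fib t ≤ 2 * Nat.fib (t + 1) := by have := Nat.fib_le_fib_succ (n := t); omega
  have h5 : (-1 : ℝ) ^ t = (if Even t then 2 else 0) - 1 := by
    split_ifs with h
    · rw [h.neg_one_pow]; norm_num
    · rw [(Nat.not_even_iff_odd.1 h).neg_one_pow]; norm_num
  rw [goldenPowAddOneNorm, Nat.cast_add, Nat.cast_sub h4]
  push_cast
  linear_combination h1 + h2 - h3 - h5 + Nat.fib t * Real.goldenRatio_add_goldenConj

theorem goldenPowAddOneNorm_pos (t : ℕ) : 0 < goldenPowAddOneNorm t := by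
  have h1 := Nat.fib_le_fib_succ (n := t)
  have h2 : 0 < Nat.fib (t + 1) := Nat.fib_pos.2 (by omega)
  unfold goldenPowAddOneNorm
  omega

theorem mod_four_of_five_dvd_goldenPowAddOneNorm {t : ℕ} (h : 5 ∣ goldenPowAddOneNorm t) :
    t % 4 = 2 := by
  -- Lucas numbers `2 F_(t+1) - F_t` have period 4 modulo 5; the coefficient 4 stands for -1.
  have hper : ∀ j r, (2 * Nat.fib (4 * j + r + 1) + 4 * Nat.fib (4 * j + r)) % 5 =
      (2 * Nat.fib (r + 1) + 4 * Nat.fib r) % 5 := by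
    intro j r
    induction j with
    | zero => simp
    | succ j ih =>
      rw [← ih, show 4 * (j + 1) + r = 4 * j + r + 4 by ring]
      simp only [Nat.fib_add_two (n := 4 * j + r + 3), Nat.fib_add_two (n := 4 * j + r + 2),
        Nat.fib_add_two (n := 4 * j + r + 1), Nat.fib_add_two (n := 4 * j + r)]
      omega
  have h4 := hper (t / 4) (t % 4)
  rw [Nat.div_add_mod] at h4
  have h1 := Nat.fib_le_fib_succ (n := t)
  unfold goldenPowAddOneNorm at h
  have hlt := Nat.mod_lt t (show 4 > 0 by norm_num)
  have hev : Even t ↔ (t % 4) % 2 = 0 := by rw [Nat.even_iff]; omega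
  simp only [hev] at h
  generalize t % 4 = r at *
  interval_cases r <;> simp [Nat.fib_add_two] at h h4 ⊢ <;> omega

/-- For odd `m`, `1 = -φ ^ m ψ ^ m`, so `φ ^ m - ψ ^ m` factors out. -/
theorem goldenRatio_pow_two_mul_add_one {m : ℕ} (hm : Odd m) :
    Real.goldenRatio ^ (2 * m) + 1 = √5 * (Real.goldenRatio ^ m * Nat.fib m) := by
  have h : Real.goldenRatio ^ m * Real.goldenConj ^ m = -1 := by
    rw [← mul_pow, Real.goldenRatio_mul_goldenConj, hm.neg_one_pow]
  have h5 : √5 ≠ 0 := by positivity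
  rw [Real.coe_fib_eq]
  field_simp
  linear_combination h

theorem goldenPowAddOneNorm_two_mul {m : ℕ} (hm : Odd m) :
    goldenPowAddOneNorm (2 * m) = 5 * Nat.fib m ^ 2 := by
  have h : Real.goldenRatio ^ m * Real.goldenConj ^ m = -1 := by
    rw [← mul_pow, Real.goldenRatio_mul_goldenConj, hm.neg_one_pow]
  have hF : √5 * Nat.fib m = Real.goldenRatio ^ m - Real.goldenConj ^ m := by
    rw [Real.coe_fib_eq]; field_simp
  have h5 : √5 ^ 2 = (5 : ℝ) := Real.sq_sqrt (by norm_num)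
  have : (goldenPowAddOneNorm (2 * m) : ℝ) = 5 * Nat.fib m ^ 2 := by
    rw [cast_goldenPowAddOneNorm, ← h5, ← mul_pow, hF]
    linear_combination (Real.goldenRatio ^ m * Real.goldenConj ^ m + 1) * h
  exact_mod_cast this

theorem log_tau (t : ℕ) :
    Real.log (tau t) = Real.log (Real.goldenRatio ^ t + 1) - Real.log √5 := by
  have := Real.goldenRatio_pos
  rw [tau, Real.log_div (by positivity) (by positivity)]

theorem tau_two_mul {m : ℕ} (hm : Odd m) : tau (2 * m) = Real.goldenRatio ^ m * Nat.fib m := by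
  rw [tau, goldenRatio_pow_two_mul_add_one hm]
  field_simp

theorem norm_eq_of_log_eq {p q A B C D t s : ℕ}
    (h : p * Real.log Real.goldenRatio + A * Real.log √5 + B * Real.log (Real.goldenRatio ^ t + 1) =
      q * Real.log Real.goldenRatio + C * Real.log √5 +
        D * Real.log (Real.goldenRatio ^ s + 1)) :
    5 ^ A * goldenPowAddOneNorm t ^ B = 5 ^ C * goldenPowAddOneNorm s ^ D := by
  have hpos := Real.goldenRatio_pos
  have hlog : ∀ p A B t : ℕ, p * Real.log Real.goldenRatio + A * Real.log √5 +
      B * Real.log (Real.goldenRatio ^ t + 1) =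
      Real.log (Real.goldenRatio ^ p * √5 ^ A * (Real.goldenRatio ^ t + 1) ^ B) := by
    intro p A B t
    rw [Real.log_mul (by positivity) (by positivity), Real.log_mul (by positivity) (by positivity),
      Real.log_pow, Real.log_pow, Real.log_pow]
  rw [hlog, hlog] at h
  have h1 := Real.log_injOn_pos (Set.mem_Ioi.2 (by positivity)) (Set.mem_Ioi.2 (by positivity)) h
  have h5 : √5 = Real.goldenRatio + Real.goldenRatio - 1 := by rw [Real.goldenRatio]; ring
  have h5' : -√5 = Real.goldenConj + Real.goldenConj - 1 := by rw [Real.goldenConj]; ring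
  have h2 := aeval_goldenConj_eq_zero
    (.X ^ p * (.X + .X - 1) ^ A * (.X ^ t + 1) ^ B - .X ^ q * (.X + .X - 1) ^ C * (.X ^ s + 1) ^ D)
    (by
      have h1 := h1
      rw [h5] at h1
      simpa [sub_eq_zero] using h1)
  have h2 : Real.goldenConj ^ p * (-√5) ^ A * (Real.goldenConj ^ t + 1) ^ B =
      Real.goldenConj ^ q * (-√5) ^ C * (Real.goldenConj ^ s + 1) ^ D := by
    rw [h5']
    simpa [sub_eq_zero] using h2
  -- The absolute value absorbs the signs of the norms -1 of `φ` and -5 of `√5`.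
  have h3 : ∀ p A B t : ℕ, |Real.goldenRatio ^ p * √5 ^ A * (Real.goldenRatio ^ t + 1) ^ B *
      (Real.goldenConj ^ p * (-√5) ^ A * (Real.goldenConj ^ t + 1) ^ B)| =
      (5 ^ A * goldenPowAddOneNorm t ^ B : ℕ) := by
    intro p A B t
    have e : Real.goldenRatio ^ p * √5 ^ A * (Real.goldenRatio ^ t + 1) ^ B *
      (Real.goldenConj ^ p * (-√5) ^ A * (Real.goldenConj ^ t + 1) ^ B) =
      (Real.goldenRatio * Real.goldenConj) ^ p * (-(√5 * √5)) ^ A *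
      ((Real.goldenRatio ^ t + 1) * (Real.goldenConj ^ t + 1)) ^ B := by
      rw [← mul_neg]
      simp only [mul_pow]; ring
    rw [e, Real.mul_self_sqrt (by norm_num), ← cast_goldenPowAddOneNorm,
      Real.goldenRatio_mul_goldenConj]
    simp [abs_mul, abs_pow]
  have h4 := h3 p A B t
  rw [h1, h2, h3] at h4
  exact_mod_cast h4.symm

/-! ### The three linear forms -/

theorem Lambda4a_ne_zero {Δ : ℤ} {a₁ a₂ : ℕ} (ha₁ : 0 < a₁) (ha : a₁ < a₂) (t : ℕ) :
    Lambda4a Δ a₁ a₂ t ≠ 0 := by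
  intro h
  -- Splitting `Δ` keeps all exponents natural, as the polynomial argument requires.
  obtain ⟨p, q, rfl⟩ : ∃ p q : ℕ, Δ = p - q := ⟨Δ.toNat, (-Δ).toNat, by omega⟩
  have hN := norm_eq_of_log_eq (p := p) (q := q) (A := a₂ - a₁) (B := 0) (C := 0) (D := a₂)
    (t := t) (s := t) (by
      rw [Lambda4a, log_tau] at h
      push_cast [Nat.cast_sub ha.le] at h ⊢
      linarith)
  simp only [pow_zero, mul_one, one_mul] at hN
  have h5 : Nat.Prime 5 := by norm_num
  obtain ⟨j, -, hj⟩ := (Nat.dvd_prime_pow h5).1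
    (hN ▸ dvd_pow_self (goldenPowAddOneNorm t) (by omega : a₂ ≠ 0))
  rw [hj, ← pow_mul] at hN
  have he := Nat.pow_right_injective (le_refl 2 |>.trans (by norm_num : 2 ≤ 5)) hN
  rcases Nat.eq_zero_or_pos j with rfl | hj0
  · omega
  · have := Nat.le_mul_of_pos_left a₂ hj0
    omega

theorem Lambda4b_ne_zero {Δ : ℤ} {a₁ a₂ : ℕ} (ha : a₁ < a₂) (t : ℕ) :
    Lambda4b Δ a₁ a₂ t ≠ 0 := by
  intro h
  obtain ⟨p, q, rfl⟩ : ∃ p q : ℕ, Δ = p - q := ⟨Δ.toNat, (-Δ).toNat, by omega⟩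
  have hN := norm_eq_of_log_eq (p := p) (q := q) (A := a₁) (B := 0) (C := a₂) (D := a₁)
    (t := t) (s := t) (by
      rw [Lambda4b, log_tau] at h
      push_cast at h ⊢
      linarith)
  have h1 : 5 ^ a₁ < 5 ^ a₂ := Nat.pow_lt_pow_right (by norm_num) ha
  have h2 := Nat.le_mul_of_pos_right (5 ^ a₂) (pow_pos (goldenPowAddOneNorm_pos t) a₁)
  rw [← hN, pow_zero, mul_one] at h2
  exact h1.not_ge h2

theorem tau_two : tau 2 = Real.goldenRatio := by
  simpa using tau_two_mul odd_one

theorem Lambda5_eq_zero_iff {Δ : ℤ} {a₁ a₂ : ℕ} (ha₁ : 0 < a₁) (ha : a₁ < a₂) (t₁ t₂ : ℕ) :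
    Lambda5 Δ a₁ a₂ t₁ t₂ = 0 ↔ t₁ = 2 ∧ t₂ = 2 ∧ Δ + a₂ - a₁ = 0 := by
  have key : Lambda5 Δ a₁ a₂ 2 2 = ((Δ + a₂ - a₁ : ℤ) : ℝ) * Real.log Real.goldenRatio := by
    rw [Lambda5, tau_two]; push_cast; ring
  constructor
  swap
  · rintro ⟨rfl, rfl, h⟩
    rw [key, h, Int.cast_zero, zero_mul]
  intro h
  suffices H : t₁ = 2 ∧ t₂ = 2 by
    obtain ⟨rfl, rfl⟩ := H
    refine ⟨rfl, rfl, ?_⟩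
    rw [key] at h
    exact_mod_cast (mul_eq_zero.1 h).resolve_right (Real.log_pos Real.one_lt_goldenRatio).ne'
  obtain ⟨p, q, rfl⟩ : ∃ p q : ℕ, Δ = p - q := ⟨Δ.toNat, (-Δ).toNat, by omega⟩
  have hN := norm_eq_of_log_eq (p := p) (q := q) (A := a₁) (B := a₂) (C := a₂) (D := a₁)
    (t := t₂) (s := t₁) (by
      rw [Lambda5, log_tau, log_tau] at h
      push_cast at h ⊢
      linarith)
  have h5 : Nat.Prime 5 := by norm_num
  have h5N₂ : 5 ∣ goldenPowAddOneNorm t₂ := by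
    obtain ⟨d, rfl⟩ := Nat.exists_eq_add_of_lt ha
    rw [add_assoc, pow_add 5, mul_assoc] at hN
    have := Nat.eq_of_mul_eq_mul_left (by positivity) hN
    exact h5.dvd_of_dvd_pow (this ▸ (dvd_pow_self 5 (by omega)).mul_right _)
  have half : ∀ {t : ℕ}, 5 ∣ goldenPowAddOneNorm t → ∃ m, Odd m ∧ t = 2 * m := fun {t} ht => by
    have := mod_four_of_five_dvd_goldenPowAddOneNorm ht
    exact ⟨t / 2, by rw [Nat.odd_iff]; omega, by omega⟩
  obtain ⟨m, hm, rfl⟩ := half h5N₂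
  rw [goldenPowAddOneNorm_two_mul hm, mul_pow, mul_left_comm] at hN
  replace hN := Nat.eq_of_mul_eq_mul_left (by positivity) hN
  have h5N₁ : 5 ∣ goldenPowAddOneNorm t₁ :=
    h5.dvd_of_dvd_pow (hN ▸ (dvd_pow_self 5 ha₁.ne').mul_right _)
  obtain ⟨n, hn, rfl⟩ := half h5N₁
  rw [goldenPowAddOneNorm_two_mul hn, mul_pow] at hN
  replace hN := Nat.eq_of_mul_eq_mul_left (by positivity) hN
  rw [pow_right_comm, pow_right_comm (Nat.fib n)] at hN
  obtain ⟨rfl, rfl⟩ :=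
    eq_one_of_fib_pow_eq_fib_pow hm hn ha₁ ha (Nat.pow_left_injective two_ne_zero hN)
  exact ⟨rfl, rfl⟩

theorem mainTheorem9 (a₁ a₂ Δ : ℤ) (ha₁ : 0 < a₁) (ha : a₁ < a₂) :
    (∀ t : ℕ, 0 < t → Lambda4a Δ a₁ a₂ t ≠ 0) ∧
    (∀ t : ℕ, 0 < t → Lambda4b Δ a₁ a₂ t ≠ 0) ∧
    (∀ t₁ t₂ : ℕ, 0 < t₁ → 0 < t₂ →
      (Lambda5 Δ a₁ a₂ t₁ t₂ = 0 ↔ t₁ = 2 ∧ t₂ = 2 ∧ Δ + a₂ - a₁ = 0)) := by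
  lift a₁ to ℕ using ha₁.le
  lift a₂ to ℕ using (ha₁.trans ha).le
  have ha₁ : 0 < a₁ := by exact_mod_cast ha₁
  have ha : a₁ < a₂ := by exact_mod_cast ha
  exact ⟨fun t _ => Lambda4a_ne_zero ha₁ ha t, fun t _ => Lambda4b_ne_zero ha t,
    fun t₁ t₂ _ _ => Lambda5_eq_zero_iff ha₁ ha t₁ t₂⟩
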